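/- **Setting.** Let $\Sigma$ be an arbitrary (possibly infinite) vocabulary. A text is a finite sequence of words of $\Sigma$, and $G_k(w)$ is the set of contiguous length-$k$ subsequences ($k$-grams) of the text $w$. A database consists of finitely many users, each user $i$ having a text $w_i$; two databases are adjacent if one of them is obtained from the other by adding exactly one user (the order of the users is immaterial). A randomized algorithm $A$ is $(\epsilon,\delta)$-differentially private if $\Pr[A(D)\in\mathcal S]\le e^{\epsilon}\Pr[A(D')\in\mathcal S]+\delta$ for all adjacent $D,D'$ and all sets $\mathcal S$ of outputs. Let $\Phi$ be the distribution function of the standard Gaussian. **DPNE algorithm.** Parameters: a maximal length $T\ge1$, contribution bounds $\Delta_1,\dots,\Delta_T\in\mathbb N$ with $\Delta_1\ge1$, thresholds $\rho_1,\dots,\rho_T\in\mathbb R$ and noise parameters $\sigma_1,\dots,\sigma_T>0$. For $k=1,\dots,T$ in turn a finite set $S_k$ of $k$-grams is produced as follows. For $k\ge2$ let $V_k=(S_1\times S_{k-1})\cap(S_{k-1}\times S_1)$ (pairs being read as concatenations), and for every user $i$ let $U_i=G_k(w_i)\cap V_k$; for $k=1$ let $U_i=G_1(w_i)$. If $|U_i|>\Delta_k$,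 replace $U_i$ by a uniformly random subset of it with $\Delta_k$ elements (all random choices being independent). Let $H_k[u]=\sum_{i:\,u\in U_i}|U_i|^{-1/2}$. Finally, let $S_k$ be the set of those keys $u$ for which $H_k[u]+Z_u>\rho_k$, where the $Z_u\sim N(0,\sigma_k^2)$ are independent; for $k\ge2$ the keys are all elements of $V_k$ (including those of weight $0$), and for $k=1$ the keys are the elements of $\bigcup_iU_i$. The output is $(S_1,\dots,S_T)$. For $k\ge2$ the threshold $\rho_k$ may also be computed from $S_1,\dots,S_{k-1}$ by any fixed function. **Theorem.** Let $\epsilon>0$ and $0<\delta<1$, and let $\sigma^*>0$ satisfy $$\frac{\delta}{2}=\Phi\Big(-\epsilon\sigma^*+\frac1{2\sigma^*}\Big)-e^{\epsilon}\,\Phi\Big(-\epsilon\sigma^*-\frac1{2\sigma^*}\Big).$$ Suppose that $$\frac1{\sigma^*}=\sqrt{\frac1{\sigma_1^2}+\dots+\frac1{\sigma_T^2}},\qquad \rho_1=\max_{1\le t\le\Delta_1}\Big(\frac1{\sqrt t}+\sigma_1\,\Phi^{-1}\Big(\big(1-\tfrac{\delta}{2}\big)^{1/t}\Big)\Big).$$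 Then, whatever the thresholds $\rho_2,\dots,\rho_T$ and the contribution bounds $\Delta_2,\dots,\Delta_T$ are, the DPNE algorithm is $(\epsilon,\delta)$-differentially private. -/

import Mathlib

noncomputable section

namespace DPNE

open MeasureTheory ProbabilityTheory

/-! ### Gaussian distribution function -/

/-- The distribution function `Φ` of the standard Gaussian. -/
def Phi (x : ℝ) : ℝ := cdf (gaussianReal 0 1) x

/-- The quantile function `Φ⁻¹` of the standard Gaussian (the inverse of `Φ` on `(0, 1)`). -/
def PhiInv (p : ℝ) : ℝ := sInf {x : ℝ | p ≤ Phi x}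

/-! ### Differential privacy -/

/-- `(ε, δ)`-differential privacy of a randomized algorithm `A` whose output on the database `D` has
the (discrete) law `A D`. Every set of outputs is an event. -/
def IsDifferentiallyPrivate {Db Out : Type*} (Adj : Db → Db → Prop) (ε δ : ℝ)
    (A : Db → PMF Out) : Prop :=
  ∀ D D' : Db, Adj D D' → ∀ S : Set Out,
    (A D).toOuterMeasure S ≤
      ENNReal.ofReal (Real.exp ε) * (A D').toOuterMeasure S + ENNReal.ofReal δ

/-! ### Texts, n-grams, databases -/

/-- A text, or an n-gram, is a finite sequence of words of the vocabulary `α`. -/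
abbrev Text (α : Type*) := List α

/-- A database lists the texts of its users. -/
abbrev Database (α : Type*) := List (Text α)

/-- One of the databases consists of the users of the other one and exactly one further user.
The order in which the users are listed is immaterial. -/
def Adjacent {α : Type*} (D D' : Database α) : Prop :=
  ∃ w : Text α, D'.Perm (w :: D) ∨ D.Perm (w :: D')

open Classical in
/-- `G_k(w)`: the set of all contiguous subsequences of length `k` of the text `w`. -/
def grams {α : Type*} (k : ℕ) (w : Text α) : Finset (Text α) :=
  w.sublists.toFinset.filter (fun u => u.length = k ∧ u <:+: w)

theorem mem_grams {α : Type*} {k : ℕ} {w u : Text α} :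
    u ∈ grams k w ↔ u.length = k ∧ u <:+: w := by
  simp only [grams, Finset.mem_filter, List.mem_toFinset, List.mem_sublists]
  exact ⟨fun h => h.2, fun h => ⟨h.2.sublist, h⟩⟩

open Classical in
/-- `(S₁ × S') ∩ (S' × S₁)`, where a pair of sequences is read as their concatenation. -/
def validGrams {α : Type*} (S₁ S' : Finset (Text α)) : Finset (Text α) :=
  Finset.image₂ (fun a b => a ++ b) S₁ S' ∩ Finset.image₂ (fun b a => b ++ a) S' S₁

/-! ### Weighted Gaussian histograms -/

/-- Limiting a user's contribution: if `U` has more than `Δ` elements, it is replaced by a uniformly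
random subset of `U` with exactly `Δ` elements. -/
def limitContribution {β : Type*} (Δ : ℕ) (U : Finset β) : PMF (Finset β) :=
  if h : Δ < U.card then
    PMF.uniformOfFinset (U.powersetCard Δ) (Finset.powersetCard_nonempty.2 h.le)
  else PMF.pure U

/-- The contribution of a user with the set `U`: weight `1 / √|U|` on every element of `U`. -/
def contribution {β : Type*} (U : Finset β) : β →₀ ℝ :=
  ∑ u ∈ U, Finsupp.single u (1 / Real.sqrt (U.card : ℝ))

/-- The random histogram (a dictionary with default value `0`) obtained when every user `i` in turn
contributes with the item set `Uᵢ`, limited to `Δ` items by an independent random choice. -/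
def histogram {β : Type*} (Δ : ℕ) : List (Finset β) → PMF (β →₀ ℝ)
  | [] => PMF.pure 0
  | U :: Us =>
      (limitContribution Δ U).bind fun U' =>
        (histogram Δ Us).map fun H => contribution U' + H

/-- Law of the vector of decisions `H[u] + N(0, σ²) > ρ` for `u ∈ V`, with independent noise for
the different `u`. -/
def noisyDecisions {β : Type*} (V : Finset β) (H : β → ℝ) (σ ρ : ℝ) : Measure (V → Bool) :=
  (Measure.pi fun _ : V => gaussianReal 0 (Real.toNNReal (σ ^ 2))).map
    fun z u => decide (H u + z u > ρ)

theorem measurable_decisions {β : Type*} (V : Finset β) (H : β → ℝ) (ρ : ℝ) :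
    Measurable fun (z : V → ℝ) (u : V) => decide (H u + z u > ρ) := by
  refine measurable_pi_lambda _ fun u => ?_
  refine measurable_to_bool ?_
  have : (fun z : V → ℝ => decide (H u + z u > ρ)) ⁻¹' {true} = {z | ρ < H u + z u} := by
    ext z; simp
  rw [this]
  exact measurableSet_lt measurable_const (measurable_const.add (measurable_pi_apply u))

instance instIsProbabilityMeasureNoisyDecisions {β : Type*} (V : Finset β) (H : β → ℝ) (σ ρ : ℝ) :
    IsProbabilityMeasure (noisyDecisions V H σ ρ) :=
  Measure.isProbabilityMeasure_map (measurable_decisions V H ρ).aemeasurable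

/-- Law of the set of those `u ∈ V` for which `H[u] + N(0, σ²) > ρ`. -/
def noisyThreshold {β : Type*} (V : Finset β) (H : β → ℝ) (σ ρ : ℝ) : PMF (Finset β) :=
  (noisyDecisions V H σ ρ).toPMF.map fun b =>
    (V.attach.filter fun u => b u = true).map (Function.Embedding.subtype _)

/-! ### The algorithms -/

/-- The DPSU algorithm with the weighted Gaussian policy, for `1`-grams: only the items that some
user contributed are keys of the histogram. -/
def dpsu {α : Type*} (Δ : ℕ) (ρ σ : ℝ) (D : Database α) : PMF (Finset (Text α)) :=
  (histogram Δ (D.map (grams 1))).bind fun H => noisyThreshold H.support H σ ρ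

open Classical in
/-- Extraction of `k`-grams from the set `V` of valid `k`-grams: users contribute their valid
`k`-grams, and all elements of `V` (also those of weight `0`) are keys of the histogram. -/
def extractGrams {α : Type*} (k : ℕ) (V : Finset (Text α)) (Δ : ℕ) (ρ σ : ℝ) (D : Database α) :
    PMF (Finset (Text α)) :=
  (histogram Δ (D.map fun w => grams k w ∩ V)).bind fun H => noisyThreshold V H σ ρ

/-- The DPNE algorithm for n-grams of length at most `T`. The output is the family `S` with
`S k = S_k` for `1 ≤ k ≤ T`, padded by `S k = ∅` for all other `k`. The maximum contribution and
noise parameters are `Δ k` and `σ k`, the threshold for `1`-grams is `ρ₁`, and the threshold for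
`k`-grams with `2 ≤ k` is `ρ k S`, which may be computed from the family `S` of the sets
`S_1, …, S_{k-1}` extracted before. -/
def dpne {α : Type*} (Δ : ℕ → ℕ) (ρ₁ : ℝ) (ρ : ℕ → (ℕ → Finset (Text α)) → ℝ) (σ : ℕ → ℝ)
    (D : Database α) : (T : ℕ) → PMF (ℕ → Finset (Text α))
  | 0 => PMF.pure fun _ => ∅
  | 1 => (dpsu (Δ 1) ρ₁ (σ 1) D).map fun S₁ => Function.update (fun _ => ∅) 1 S₁
  | k + 2 =>
      (dpne Δ ρ₁ ρ σ D (k + 1)).bind fun S =>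
        (extractGrams (k + 2) (validGrams (S 1) (S (k + 1))) (Δ (k + 2)) (ρ (k + 2) S)
          (σ (k + 2)) D).map fun A => Function.update S (k + 2) A

end DPNE

end

noncomputable section

namespace DPNE

open MeasureTheory ProbabilityTheory
open scoped ENNReal NNReal MeasureTheory

/-! Privacy loss is tracked by two relations between laws. `Dominated v P Q` bounds every
hockey-stick divergence of `(P, Q)` by that of `(N(v, v), N(0, v))`, a Gaussian shift by `√v`
standard deviations; `Close η P Q` allows an additive error `η`. Gaussian log-likelihood ratios add
up under convolution, so `Dominated.bind` composes adaptively by adding the parameters `v`.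

In a round `k ≥ 2` the keys depend only on earlier outputs, and one user moves the histogram by a
vector of norm at most 1. By `dominated_noisyThreshold` the round costs `1 / σ_k²`. In round 1 the
keys depend on the database, so `dpsu_cons` inserts a law `M`: the histogram of one database
thresholded on the keys of the other. Replacing `M` by the other database's law costs `1 / σ_1²`;
replacing the first law by `M` costs the probability that a key held only by the additional user
passes, at most `δ / 2` by the choice of `ρ_1`.

The parameters sum to `1 / σ*²`, and the corresponding divergence at `(1, e^ε)` is the other `δ / 2`
(`gaussianDivergence_one_exp`). -/

theorem Phi_nonneg (x : ℝ) : 0 ≤ Phi x := cdf_nonneg _ x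

/-! ### Gaussian shifts and their hockey-stick divergence -/

/-- The likelihood ratio of `N(v, v)` with respect to `N(0, v)`. -/
def likelihoodRatio (v : ℝ≥0) (l : ℝ) : ℝ≥0∞ := ENNReal.ofReal (Real.exp (l - v / 2))

@[fun_prop]
theorem measurable_likelihoodRatio (v : ℝ≥0) : Measurable (likelihoodRatio v) := by
  unfold likelihoodRatio; fun_prop

theorem likelihoodRatio_ne_top (v : ℝ≥0) (l : ℝ) : likelihoodRatio v l ≠ ∞ :=
  ENNReal.ofReal_ne_top

theorem likelihoodRatio_add (v w : ℝ≥0) (x y : ℝ) :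
    likelihoodRatio (v + w) (x + y) = likelihoodRatio v x * likelihoodRatio w y := by
  rw [likelihoodRatio, likelihoodRatio, likelihoodRatio,
    ← ENNReal.ofReal_mul (Real.exp_pos _).le, ← Real.exp_add]
  congr 2
  push_cast
  ring

theorem gaussianReal_eq_withDensity (m : ℝ) {v : ℝ≥0} (hv : v ≠ 0) :
    gaussianReal m v = (gaussianReal 0 v).withDensity
      fun x => ENNReal.ofReal (Real.exp (m / v * x - m ^ 2 / v / 2)) := by
  have hv' : (0 : ℝ) < v := by positivity
  rw [gaussianReal_of_var_ne_zero _ hv, gaussianReal_of_var_ne_zero _ hv,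
    ← withDensity_mul _ (measurable_gaussianPDF 0 v) (by fun_prop)]
  congr 1
  ext x
  rw [Pi.mul_apply, gaussianPDF, gaussianPDF,
    ← ENNReal.ofReal_mul (gaussianPDFReal_nonneg _ _ _), gaussianPDFReal, gaussianPDFReal,
    mul_assoc _ (Real.exp _), ← Real.exp_add]
  congr 3
  field_simp
  ring

theorem withDensity_likelihoodRatio (v : ℝ≥0) :
    (gaussianReal 0 v).withDensity (likelihoodRatio v) = gaussianReal v v := by
  rcases eq_or_ne v 0 with rfl | hv
  · classical
    have : likelihoodRatio 0 0 = 1 := by simp [likelihoodRatio]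
    ext s hs
    rw [withDensity_apply _ hs]
    simp only [gaussianReal_zero_var, NNReal.coe_zero]
    rw [setLIntegral_dirac' (measurable_likelihoodRatio 0) hs, this,
      Measure.dirac_apply' _ hs, Set.indicator_apply]
    rfl
  · have hv' : (v : ℝ) ≠ 0 := by exact_mod_cast hv
    rw [gaussianReal_eq_withDensity v hv]
    congr 1
    ext x
    rw [likelihoodRatio]
    congr 2
    field_simp

theorem lintegral_likelihoodRatio (v : ℝ≥0) :
    ∫⁻ l, likelihoodRatio v l ∂gaussianReal 0 v = 1 := by
  rw [← setLIntegral_univ, ← withDensity_apply _ MeasurableSet.univ, withDensity_likelihoodRatio,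
    measure_univ]

/-- The hockey-stick divergence `∫ (a dN(v, v) - b dN(0, v))₊`. -/
def gaussianDivergence (v : ℝ≥0) (a b : ℝ≥0∞) : ℝ≥0∞ :=
  ∫⁻ l, (a * likelihoodRatio v l - b) ∂gaussianReal 0 v

theorem gaussianDivergence_zero (a b : ℝ≥0∞) : gaussianDivergence 0 a b = a - b := by
  simp [gaussianDivergence, likelihoodRatio]

theorem gaussianDivergence_zero_left (v : ℝ≥0) (b : ℝ≥0∞) : gaussianDivergence v 0 b = 0 := by
  simp [gaussianDivergence]

/-- The likelihood ratio at `x + y` factors, and the factor in `y` is absorbed into `a`. This is why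
domination is required for all `a`, `b`. -/
theorem gaussianDivergence_add (v w : ℝ≥0) (a b : ℝ≥0∞) :
    gaussianDivergence (v + w) a b
      = ∫⁻ y, gaussianDivergence v (a * likelihoodRatio w y) b ∂gaussianReal 0 w := by
  have hconv : gaussianReal 0 (v + w) = (gaussianReal 0 w) ∗ (gaussianReal 0 v) := by
    rw [gaussianReal_conv_gaussianReal, add_zero, add_comm]
  rw [gaussianDivergence, hconv, Measure.lintegral_conv (by fun_prop)]
  refine lintegral_congr fun y => ?_
  rw [gaussianDivergence]
  refine lintegral_congr fun x => ?_
  rw [add_comm y x, likelihoodRatio_add, mul_assoc, mul_comm (likelihoodRatio w y)]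

/-- Jensen's inequality for the positive part: the extra likelihood factor has mean 1. -/
theorem gaussianDivergence_mono {v w : ℝ≥0} (h : v ≤ w) {a : ℝ≥0∞} (b : ℝ≥0∞) :
    gaussianDivergence v a b ≤ gaussianDivergence w a b := by
  obtain ⟨u, rfl⟩ := exists_add_of_le h
  rw [add_comm v u, gaussianDivergence_add, gaussianDivergence]
  refine lintegral_mono fun y => ?_
  calc a * likelihoodRatio v y - b
      = ∫⁻ x, a * likelihoodRatio v y * likelihoodRatio u x ∂gaussianReal 0 u
          - ∫⁻ _, b ∂gaussianReal 0 u := by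
        rw [lintegral_const_mul _ (by fun_prop), lintegral_likelihoodRatio]
        simp
    _ ≤ _ := lintegral_sub_le _ _ measurable_const

/-! ### Domination and composition -/

/-- The pair `(P, Q)` is at most as distinguishable as the pair `(N(v, v), N(0, v))`. -/
def Dominated {β : Type*} (v : ℝ≥0) (P Q : PMF β) : Prop :=
  ∀ a b : ℝ≥0∞, a ≠ ∞ → b ≠ ∞ → ∑' x, (a * P x - b * Q x) ≤ gaussianDivergence v a b

theorem Dominated.mono {β : Type*} {v w : ℝ≥0} {P Q : PMF β} (h : Dominated v P Q) (hvw : v ≤ w) :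
    Dominated w P Q :=
  fun a b ha hb => (h a b ha hb).trans (gaussianDivergence_mono hvw b)

theorem Dominated.refl {β : Type*} (P : PMF β) : Dominated 0 P P := by
  intro a b ha hb
  rw [gaussianDivergence_zero]
  rcases le_total a b with h | h
  · rw [ENNReal.tsum_eq_zero.2]
    · exact zero_le
    · exact fun x => tsub_eq_zero_of_le (by gcongr)
  · have : ∀ x, a * P x - b * P x = (a - b) * P x := fun x =>
      (ENNReal.sub_mul fun _ _ => P.apply_ne_top x).symm
    simp_rw [this]
    rw [ENNReal.tsum_mul_left, P.tsum_coe, mul_one]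

theorem tsum_sub_tsum_le {ι : Type*} (f g : ι → ℝ≥0∞) :
    ∑' i, f i - ∑' i, g i ≤ ∑' i, (f i - g i) := by
  rw [tsub_le_iff_right, ← ENNReal.tsum_add]
  exact ENNReal.tsum_le_tsum fun i => le_tsub_add

/-- Adaptive composition. -/
theorem Dominated.bind {β γ : Type*} {v w : ℝ≥0} {P Q : PMF β} {f g : β → PMF γ}
    (h : Dominated v P Q) (hfg : ∀ x, Dominated w (f x) (g x)) :
    Dominated (v + w) (P.bind f) (Q.bind g) := by
  intro a b ha hb
  -- `β` may be uncountable; exchanging sum and integral below needs a countable index set.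
  have hc : Countable P.support := P.support_countable.to_subtype
  have hsub : ∀ F : β → ℝ≥0∞, (∀ x, P x = 0 → F x = 0) →
      ∑' x : P.support, F x = ∑' x, F x := fun F hF =>
    tsum_subtype_eq_of_support_subset fun x hx hx' => hx (hF x hx')
  calc ∑' z, (a * P.bind f z - b * Q.bind g z)
      ≤ ∑' z, ∑' x, (a * P x * f x z - b * Q x * g x z) := by
        refine ENNReal.tsum_le_tsum fun z => ?_
        simp_rw [PMF.bind_apply, mul_assoc]
        rw [← ENNReal.tsum_mul_left, ← ENNReal.tsum_mul_left]
        exact tsum_sub_tsum_le _ _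
    _ = ∑' x, ∑' z, (a * P x * f x z - b * Q x * g x z) := ENNReal.tsum_comm
    _ ≤ ∑' x, gaussianDivergence w (a * P x) (b * Q x) := ENNReal.tsum_le_tsum fun x =>
        hfg x _ _ (ENNReal.mul_ne_top ha (P.apply_ne_top x))
          (ENNReal.mul_ne_top hb (Q.apply_ne_top x))
    _ = ∑' x : P.support, gaussianDivergence w (a * P x) (b * Q x) :=
        (hsub _ fun x hx => by rw [hx, mul_zero, gaussianDivergence_zero_left]).symm
    _ = ∫⁻ y, ∑' x : P.support, (a * P x * likelihoodRatio w y - b * Q x) ∂gaussianReal 0 w :=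
        (lintegral_tsum fun x => by fun_prop).symm
    _ = ∫⁻ y, ∑' x, (a * likelihoodRatio w y * P x - b * Q x) ∂gaussianReal 0 w := by
        refine lintegral_congr fun y => ?_
        simp_rw [mul_right_comm a]
        exact hsub (fun x => a * likelihoodRatio w y * P x - b * Q x) fun x hx => by simp [hx]
    -- For each fixed `y` the second round's likelihood ratio acts as a constant factor, so `h`
    -- applies with an enlarged `a`.
    _ ≤ ∫⁻ y, gaussianDivergence v (a * likelihoodRatio w y) b ∂gaussianReal 0 w :=
        lintegral_mono fun y =>
          h _ _ (ENNReal.mul_ne_top ha (likelihoodRatio_ne_top w y)) hb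
    _ = gaussianDivergence (v + w) a b := (gaussianDivergence_add v w a b).symm

theorem Dominated.map {β γ : Type*} {v : ℝ≥0} {P Q : PMF β} (h : Dominated v P Q) (f : β → γ) :
    Dominated v (P.map f) (Q.map f) := by
  simpa [PMF.map, Function.comp_def] using h.bind fun x => Dominated.refl (PMF.pure (f x))

theorem Dominated.bind_left {β γ : Type*} {w : ℝ≥0} (P : PMF β) {f g : β → PMF γ}
    (hfg : ∀ x, Dominated w (f x) (g x)) : Dominated w (P.bind f) (P.bind g) := by
  simpa using (Dominated.refl P).bind hfg

/-- The hockey-stick divergence in terms of the Gaussian distribution function. -/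
theorem gaussianDivergence_one_exp {s : ℝ} (hs : 0 < s) {v : ℝ≥0} (hv : (v : ℝ) = 1 / s ^ 2)
    (ε : ℝ) :
    gaussianDivergence v 1 (ENNReal.ofReal (Real.exp ε)) =
      ENNReal.ofReal (Phi (-ε * s + 1 / (2 * s)) - Real.exp ε * Phi (-ε * s - 1 / (2 * s))) := by
  -- The integrand is positive exactly on this half-line. The reflection `x ↦ m - x / s` turns its
  -- upper tail into a value of `Phi`, up to a null endpoint.
  have hgt : ∀ m : ℝ, gaussianReal m v (Set.Ioi (ε + v / 2)) =
      ENNReal.ofReal (Phi ((m - (ε + v / 2)) * s)) := by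
    intro m
    have hmap : (gaussianReal 0 1).map (fun x => m - x / s) = gaussianReal m v := by
      have : (fun x : ℝ => m - x / s) = (fun x => m - x) ∘ fun x => x / s := rfl
      rw [this, ← Measure.map_map (by fun_prop) (by fun_prop), gaussianReal_map_div_const,
        gaussianReal_map_const_sub]
      congr 1
      · simp
      · ext; simp [hv]
    have hnn : (gaussianReal 0 1) {((m - (ε + v / 2)) * s)} = 0 :=
      (nullSingletonClass_gaussianReal one_ne_zero).measure_singleton _
    rw [← hmap, Measure.map_apply (by fun_prop) measurableSet_Ioi, Phi, ofReal_cdf,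
      ← measure_sdiff_null (s := Set.Iic _) hnn]
    congr 1
    ext x
    simp only [Set.mem_preimage, Set.mem_Ioi, Set.mem_sdiff, Set.mem_Iic, Set.mem_singleton_iff]
    rw [← ne_eq, ← lt_iff_le_and_ne, lt_sub_comm, div_lt_iff₀ hs]
  have hset : MeasurableSet (Set.Ioi (ε + (v : ℝ) / 2)) := measurableSet_Ioi
  have hle : ∀ l, ENNReal.ofReal (Real.exp ε) ≤ likelihoodRatio v l ↔ ε + v / 2 ≤ l := by
    intro l
    rw [likelihoodRatio, ENNReal.ofReal_le_ofReal_iff (Real.exp_pos _).le, Real.exp_le_exp]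
    exact le_sub_iff_add_le
  have hind : gaussianDivergence v 1 (ENNReal.ofReal (Real.exp ε)) =
      ∫⁻ l in Set.Ioi (ε + (v : ℝ) / 2), (likelihoodRatio v l - ENNReal.ofReal (Real.exp ε))
        ∂gaussianReal 0 v := by
    rw [gaussianDivergence, ← lintegral_indicator hset]
    refine lintegral_congr fun l => ?_
    rw [one_mul, Set.indicator_apply]
    split_ifs with h
    · rfl
    · refine tsub_eq_zero_of_le ?_
      rw [likelihoodRatio]
      refine ENNReal.ofReal_le_ofReal (Real.exp_le_exp.2 ?_)
      simp only [Set.mem_Ioi, not_lt] at h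
      linarith
  rw [hind, lintegral_sub' (by fun_prop), ← withDensity_apply _ hset,
    withDensity_likelihoodRatio, setLIntegral_const, hgt, hgt, ← ENNReal.ofReal_mul (Real.exp_pos _).le,
    ← ENNReal.ofReal_sub _ (mul_nonneg (Real.exp_pos _).le (Phi_nonneg _))]
  · rw [hv]
    congr 4
    · field_simp; ring
    · field_simp; ring
  · rw [setLIntegral_const]
    exact ENNReal.mul_ne_top ENNReal.ofReal_ne_top (measure_ne_top _ _)
  · filter_upwards [ae_restrict_mem hset] with l hl
    exact (hle l).2 (le_of_lt hl)

/-! ### The Gaussian mechanism in several dimensions -/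

theorem map_sum_pi_gaussianReal {ι : Type*} [Fintype ι] (v : ℝ≥0) (c : ι → ℝ) {w : ℝ≥0}
    (hw : (w : ℝ) = ∑ i, c i ^ 2 * v) :
    (Measure.pi fun _ : ι => gaussianReal 0 v).map (fun z => ∑ i, c i * z i) =
      gaussianReal 0 w := by
  have hX : iIndepFun (fun (i : ι) (z : ι → ℝ) => c i * z i)
      (Measure.pi fun _ : ι => gaussianReal 0 v) :=
    iIndepFun_pi (X := fun i (x : ℝ) => c i * x) fun i => by fun_prop
  have hlaw : ∀ i, (Measure.pi fun _ : ι => gaussianReal 0 v).map (fun z => c i * z i) =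
      gaussianReal 0 (NNReal.mk (c i ^ 2) (sq_nonneg _) * v) := by
    intro i
    have : (fun z : ι → ℝ => c i * z i) = (fun x => c i * x) ∘ Function.eval i := rfl
    rw [this, ← Measure.map_map (by fun_prop) (by fun_prop),
      (measurePreserving_eval (fun _ : ι => gaussianReal 0 v) i).map_eq,
      gaussianReal_map_const_mul, mul_zero]
  have hmeas : ∀ i, AEMeasurable (fun z : ι → ℝ => c i * z i)
      (Measure.pi fun _ : ι => gaussianReal 0 v) := fun i =>
    Measurable.aemeasurable (by fun_prop)
  have hsum : (fun z : ι → ℝ => ∑ i, c i * z i) = ∑ i, fun z : ι → ℝ => c i * z i := by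
    ext z; simp
  refine Measure.ext_of_charFun (funext fun t => ?_)
  rw [hsum, hX.charFun_map_sum_eq_prod hmeas,
    Finset.prod_apply]
  simp_rw [hlaw, charFun_gaussianReal]
  rw [← Complex.exp_sum]
  congr 1
  rw [← Complex.ofReal_inj] at hw
  simp only [hw]
  push_cast
  simp [Finset.sum_div, Finset.sum_mul]

/-- The density depends on `z` only through a linear form, which is Gaussian by
`map_sum_pi_gaussianReal`; this reduces the vector mechanism to dimension one. -/
theorem pi_gaussianReal_eq_withDensity {ι : Type*} [Fintype ι] {v : ℝ≥0} (hv : v ≠ 0)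
    (c : ι → ℝ) :
    (Measure.pi fun i : ι => gaussianReal (c i) v) =
      (Measure.pi fun _ : ι => gaussianReal 0 v).withDensity fun z =>
        ENNReal.ofReal (Real.exp (∑ i, c i / v * z i - (∑ i, c i ^ 2 / v) / 2)) := by
  classical
  let r : ι → ℝ → ℝ≥0∞ := fun i x =>
    ENNReal.ofReal (Real.exp (c i / v * x - c i ^ 2 / v / 2))
  have hr : ∀ i, Measurable (r i) := fun i => by fun_prop
  have hprod : ∀ z : ι → ℝ,
      ENNReal.ofReal (Real.exp (∑ i, c i / v * z i - (∑ i, c i ^ 2 / v) / 2)) =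
        ∏ i, r i (z i) := by
    intro z
    rw [← ENNReal.ofReal_prod_of_nonneg fun i _ => (Real.exp_pos _).le, ← Real.exp_sum,
      Finset.sum_sub_distrib, Finset.sum_div]
  refine Measure.pi_eq fun S hS => ?_
  rw [withDensity_apply _ (MeasurableSet.univ_pi hS),
    ← lintegral_indicator (MeasurableSet.univ_pi hS)]
  have hind : ∀ z : ι → ℝ, (Set.univ.pi S).indicator (fun z : ι → ℝ =>
      ENNReal.ofReal (Real.exp (∑ i, c i / v * z i - (∑ i, c i ^ 2 / v) / 2))) z =
        ∏ i, (S i).indicator (r i) (z i) := by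
    intro z
    simp only [Set.indicator_apply, hprod]
    split_ifs with h
    · exact Finset.prod_congr rfl fun i _ => (if_pos (h i trivial)).symm
    · simp only [Set.mem_pi, Set.mem_univ, true_implies, not_forall] at h
      obtain ⟨i, hi⟩ := h
      exact (Finset.prod_eq_zero (Finset.mem_univ i) (if_neg hi)).symm
  simp_rw [hind]
  rw [lintegral_prod_eq_prod_lintegral_of_indepFun Finset.univ
    (fun i (z : ι → ℝ) => (S i).indicator (r i) (z i))
    (iIndepFun_pi (X := fun i => (S i).indicator (r i))
      fun i => ((hr i).indicator (hS i)).aemeasurable)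
    fun i => ((hr i).indicator (hS i)).comp (measurable_pi_apply i)]
  refine Finset.prod_congr rfl fun i _ => ?_
  have := (measurePreserving_eval (fun _ : ι => gaussianReal 0 v) i).lintegral_comp
    ((hr i).indicator (hS i))
  rw [gaussianReal_eq_withDensity (c i) hv, withDensity_apply _ (hS i),
    ← lintegral_indicator (hS i)]
  exact this

theorem tsum_setLIntegral_preimage {Ω γ : Type*} [MeasurableSpace Ω] [MeasurableSpace γ]
    [Countable γ] [MeasurableSingletonClass γ] (μ : Measure Ω) {f : Ω → γ} (hf : Measurable f)
    (g : Ω → ℝ≥0∞) : ∑' x, ∫⁻ z in f ⁻¹' {x}, g z ∂μ = ∫⁻ z, g z ∂μ := by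
  rw [← lintegral_iUnion (fun x => hf (measurableSet_singleton x))]
  · rw [← Set.preimage_iUnion, Set.iUnion_of_singleton, Set.preimage_univ, setLIntegral_univ]
  · intro x y hxy
    exact Disjoint.preimage f (by simpa using hxy)

/-- Moving the difference of the histograms into the mean of the noise makes both laws images under
one decision map, so data processing applies. -/
theorem noisyDecisions_eq_map {β : Type*} (V : Finset β) (H H' : β → ℝ) (σ ρ : ℝ) :
    noisyDecisions V H' σ ρ =
      (Measure.pi fun u : V => gaussianReal (H' u - H u) (Real.toNNReal (σ ^ 2))).map
        fun z (u : V) => decide (H u + z u > ρ) := by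
  have h : (Measure.pi fun u : V => gaussianReal (H' u - H u) (Real.toNNReal (σ ^ 2))) =
      (Measure.pi fun _ : V => gaussianReal 0 (Real.toNNReal (σ ^ 2))).map
        fun z (u : V) => z u + (H' u - H u) := by
    rw [Measure.pi_map_pi (f := fun (u : V) (x : ℝ) => x + (H' u - H u)) fun u => by fun_prop]
    simp [gaussianReal_map_add_const]
  rw [h, Measure.map_map (measurable_decisions V H ρ) (by fun_prop), noisyDecisions]
  congr 1
  ext z u
  simp only [Function.comp_apply]
  congr 2
  ring

/-- The Gaussian mechanism followed by thresholding. -/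
theorem dominated_noisyThreshold {β : Type*} (V : Finset β) {H H' : β → ℝ} {σ : ℝ} (hσ : 0 < σ)
    (ρ : ℝ) (hH : ∑ u ∈ V, (H' u - H u) ^ 2 ≤ 1) :
    Dominated (Real.toNNReal (1 / σ ^ 2)) (noisyThreshold V H' σ ρ) (noisyThreshold V H σ ρ) := by
  refine Dominated.map ?_ _
  set s : ℝ≥0 := Real.toNNReal (σ ^ 2) with hs
  have hs' : (s : ℝ) = σ ^ 2 := Real.coe_toNNReal _ (sq_nonneg σ)
  have hs0 : s ≠ 0 := by
    rw [← NNReal.coe_ne_zero, hs']; positivity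
  let c : V → ℝ := fun u => H' u - H u
  let w : ℝ≥0 := Real.toNNReal (∑ u, c u ^ 2 / s)
  have hw : (w : ℝ) = ∑ u, c u ^ 2 / s :=
    Real.coe_toNNReal _ (Finset.sum_nonneg fun u _ => by positivity)
  have hw_le : w ≤ Real.toNNReal (1 / σ ^ 2) := by
    refine Real.toNNReal_le_toNNReal ?_
    rw [← Finset.sum_div, hs']
    gcongr
    rwa [← Finset.sum_coe_sort V] at hH
  refine Dominated.mono (v := w) (fun a b ha hb => ?_) hw_le
  have hdec := measurable_decisions V H ρ
  have hden := pi_gaussianReal_eq_withDensity hs0 c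
  have hlin : Measurable fun z : V → ℝ => ∑ u, c u / s * z u := by fun_prop
  calc ∑' x, (a * (noisyDecisions V H' σ ρ).toPMF x - b * (noisyDecisions V H σ ρ).toPMF x)
      ≤ ∑' x, ∫⁻ z in (fun (z : V → ℝ) (u : V) => decide (H u + z u > ρ)) ⁻¹' {x},
          (a * likelihoodRatio w (∑ u, c u / s * z u) - b)
            ∂(Measure.pi fun _ : V => gaussianReal 0 s) := by
        -- On each fibre, the positive part of the integral is at most the integral of the positive
        -- part.
        refine ENNReal.tsum_le_tsum fun x => ?_
        rw [Measure.toPMF_apply, Measure.toPMF_apply, noisyDecisions_eq_map V H H', ← hs, hden,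
          Measure.map_apply hdec (measurableSet_singleton x), noisyDecisions,
          Measure.map_apply hdec (measurableSet_singleton x),
          withDensity_apply _ (hdec (measurableSet_singleton x)),
          ← lintegral_const_mul _ (by fun_prop), ← setLIntegral_const]
        refine (lintegral_sub_le _ _ measurable_const).trans_eq ?_
        simp only [likelihoodRatio, hw]
    _ = ∫⁻ z, (a * likelihoodRatio w (∑ u, c u / s * z u) - b)
            ∂(Measure.pi fun _ : V => gaussianReal 0 s) := tsum_setLIntegral_preimage _ hdec _
    _ = gaussianDivergence w a b := by
        have hmap := map_sum_pi_gaussianReal s (fun u => c u / s) (w := w) ?_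
        · rw [gaussianDivergence, ← hmap, lintegral_map (by fun_prop) hlin]
        rw [hw]
        refine Finset.sum_congr rfl fun u _ => ?_
        rw [hs']
        field_simp

/-! ### Additive closeness and changes of the key set -/

/-- Expectations of `[0, 1]`-valued functions under `P` exceed those under `Q` by at most `η`. -/
def Close {β : Type*} (η : ℝ≥0∞) (P Q : PMF β) : Prop :=
  ∀ g : β → ℝ≥0∞, (∀ x, g x ≤ 1) → ∑' x, P x * g x ≤ ∑' x, Q x * g x + η

theorem tsum_bind_mul {β γ : Type*} (p : PMF β) (f : β → PMF γ) (g : γ → ℝ≥0∞) :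
    ∑' y, p.bind f y * g y = ∑' x, p x * ∑' y, f x y * g y := by
  simp_rw [PMF.bind_apply, ← ENNReal.tsum_mul_right, ← ENNReal.tsum_mul_left]
  rw [ENNReal.tsum_comm]
  simp_rw [mul_assoc]

theorem tsum_map_mul {β γ : Type*} (p : PMF β) (f : β → γ) (g : γ → ℝ≥0∞) :
    ∑' y, p.map f y * g y = ∑' x, p x * g (f x) := by
  rw [← PMF.bind_pure_comp, tsum_bind_mul]
  refine tsum_congr fun x => ?_
  rw [tsum_eq_single (f x)]
  · simp
  · intro y hy
    simp [PMF.pure_apply, hy]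

theorem tsum_mul_le_one {β : Type*} (p : PMF β) {g : β → ℝ≥0∞} (hg : ∀ x, g x ≤ 1) :
    ∑' x, p x * g x ≤ 1 :=
  (ENNReal.tsum_le_tsum fun x => mul_le_of_le_one_right' (hg x)).trans_eq p.tsum_coe

theorem Close.bind_left {β γ : Type*} {η : ℝ≥0∞} {p : PMF β} {f f' : β → PMF γ}
    (h : ∀ x ∈ p.support, Close η (f x) (f' x)) : Close η (p.bind f) (p.bind f') := by
  intro g hg
  rw [tsum_bind_mul, tsum_bind_mul]
  calc ∑' x, p x * ∑' y, f x y * g y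
      ≤ ∑' x, (p x * ∑' y, f' x y * g y + p x * η) := by
        refine ENNReal.tsum_le_tsum fun x => ?_
        by_cases hx : p x = 0
        · simp [hx]
        · rw [← mul_add]
          gcongr
          exact h x hx g hg
    _ = _ := by rw [ENNReal.tsum_add, ENNReal.tsum_mul_right, p.tsum_coe, one_mul]

theorem Close.bind {β γ : Type*} {η : ℝ≥0∞} {P Q : PMF β} (h : Close η P Q) (f : β → PMF γ) :
    Close η (P.bind f) (Q.bind f) := by
  intro g hg
  rw [tsum_bind_mul, tsum_bind_mul]
  exact h _ fun x => tsum_mul_le_one _ hg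

theorem Close.toOuterMeasure_le {β : Type*} {η : ℝ≥0∞} {P Q : PMF β} (h : Close η P Q)
    (S : Set β) : P.toOuterMeasure S ≤ Q.toOuterMeasure S + η := by
  have hS : ∀ R : PMF β, R.toOuterMeasure S = ∑' x, R x * S.indicator 1 x := fun R => by
    rw [PMF.toOuterMeasure_apply]
    refine tsum_congr fun x => ?_
    by_cases hx : x ∈ S <;> simp [hx]
  rw [hS, hS]
  exact h _ fun x => Set.indicator_le_self' (fun _ _ => zero_le) x

/-- The outcome of thresholding, as a function of the noise. -/
def thresholdSet {β : Type*} (V : Finset β) (H : β → ℝ) (ρ : ℝ) (z : V → ℝ) : Finset β :=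
  (V.attach.filter fun u : V => H u + z u > ρ).map (Function.Embedding.subtype _)

theorem mem_thresholdSet {β : Type*} {V : Finset β} {H : β → ℝ} {ρ : ℝ} {z : V → ℝ} {u : β} :
    u ∈ thresholdSet V H ρ z ↔ ∃ h : u ∈ V, ρ < H u + z ⟨u, h⟩ := by
  simp [thresholdSet]

theorem tsum_noisyThreshold_mul {β : Type*} (V : Finset β) (H : β → ℝ) (σ ρ : ℝ)
    (g : Finset β → ℝ≥0∞) :
    ∑' x, noisyThreshold V H σ ρ x * g x = ∫⁻ z, g (thresholdSet V H ρ z)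
      ∂(Measure.pi fun _ : V => gaussianReal 0 (Real.toNNReal (σ ^ 2))) := by
  rw [noisyThreshold, tsum_map_mul]
  simp_rw [Measure.toPMF_apply, mul_comm (noisyDecisions V H σ ρ _)]
  rw [← lintegral_countable', noisyDecisions,
    lintegral_map (measurable_of_countable _) (measurable_decisions V H ρ)]
  simp [thresholdSet]

/-- Coupling: with the same noise on `V'`, the two outcomes agree unless some key outside `V` passes
the threshold. -/
theorem close_noisyThreshold {β : Type*} [DecidableEq β] {V V' : Finset β} (hV : V ⊆ V')
    (H : β → ℝ) (σ ρ : ℝ) {η : ℝ≥0∞}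
    (h : 1 - η ≤ ∏ u ∈ V' \ V, gaussianReal 0 (Real.toNNReal (σ ^ 2)) (Set.Iic (ρ - H u))) :
    Close η (noisyThreshold V' H σ ρ) (noisyThreshold V H σ ρ) ∧
      Close η (noisyThreshold V H σ ρ) (noisyThreshold V' H σ ρ) := by
  set s : ℝ≥0 := Real.toNNReal (σ ^ 2)
  set ν : Measure (V' → ℝ) := Measure.pi fun _ : V' => gaussianReal 0 s with hν
  have hrestrict : (Measure.pi fun _ : V => gaussianReal 0 s) = ν.map (Finset.restrict₂ (π := fun _ => ℝ) hV) :=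
    isProjectiveMeasureFamily_pi (fun _ : β => gaussianReal 0 s) V' V hV
  -- The event that no key outside `V` passes.
  let G : Set (V' → ℝ) := Set.univ.pi fun u => if u.1 ∈ V then Set.univ else Set.Iic (ρ - H u)
  have hG : MeasurableSet G := MeasurableSet.univ_pi fun u => by
    split_ifs
    exacts [MeasurableSet.univ, measurableSet_Iic]
  have hνG : ν G = ∏ u ∈ V' \ V, gaussianReal 0 s (Set.Iic (ρ - H u)) := by
    rw [hν, Measure.pi_pi, Finset.prod_coe_sort V'
      (fun u => gaussianReal 0 s (if u ∈ V then Set.univ else Set.Iic (ρ - H u)))]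
    rw [← Finset.prod_sdiff hV, Finset.prod_eq_one (s := V), mul_one]
    · exact Finset.prod_congr rfl fun u hu => by rw [if_neg (Finset.mem_sdiff.1 hu).2]
    · intro u hu
      rw [if_pos hu, measure_univ]
  have hbad : ν Gᶜ ≤ η := by
    rw [prob_compl_eq_one_sub hG, hνG]
    exact tsub_le_iff_tsub_le.1 h
  have heq : ∀ z ∈ G, thresholdSet V' H ρ z = thresholdSet V H ρ (Finset.restrict₂ (π := fun _ => ℝ) hV z) := by
    intro z hz
    ext u
    simp only [mem_thresholdSet, Finset.restrict₂]
    refine ⟨fun ⟨hu, hlt⟩ => ?_, fun ⟨hu, hlt⟩ => ⟨hV hu, hlt⟩⟩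
    by_cases huV : u ∈ V
    · exact ⟨huV, hlt⟩
    · have := hz ⟨u, hu⟩ trivial
      simp only [huV, if_false, Set.mem_Iic] at this
      linarith
  have hint : ∀ f f' : (V' → ℝ) → ℝ≥0∞, (∀ z, f z ≤ 1) → (∀ z ∈ G, f z = f' z) →
      ∫⁻ z, f z ∂ν ≤ ∫⁻ z, f' z ∂ν + η := by
    intro f f' hf hff'
    calc ∫⁻ z, f z ∂ν ≤ ∫⁻ z, (f' z + Gᶜ.indicator 1 z) ∂ν := by
          refine lintegral_mono fun z => ?_
          by_cases hz : z ∈ G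
          · simp [hz, hff' z hz]
          · simpa [hz] using (hf z).trans le_add_self
      _ = ∫⁻ z, f' z ∂ν + ν Gᶜ := by
          rw [lintegral_add_right _ (measurable_one.indicator hG.compl),
            lintegral_indicator_one hG.compl]
      _ ≤ _ := by gcongr
  have hmeas : ∀ g : Finset β → ℝ≥0∞, Measurable fun z : V → ℝ => g (thresholdSet V H ρ z) := by
    intro g
    have : (fun z : V → ℝ => g (thresholdSet V H ρ z)) =
        (fun b : V → Bool => g ((V.attach.filter fun u => b u = true).map
          (Function.Embedding.subtype _))) ∘ fun (z : V → ℝ) (u : V) => decide (H u + z u > ρ) := by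
      ext z; simp [thresholdSet]
    rw [this]
    exact (measurable_of_countable _).comp (measurable_decisions V H ρ)
  have hV_eq : ∀ g : Finset β → ℝ≥0∞, ∑' x, noisyThreshold V H σ ρ x * g x =
      ∫⁻ z, g (thresholdSet V H ρ (Finset.restrict₂ (π := fun _ => ℝ) hV z)) ∂ν := by
    intro g
    rw [tsum_noisyThreshold_mul, hrestrict,
      lintegral_map (hmeas g) (Finset.measurable_restrict₂ hV)]
  constructor <;> intro g hg <;> rw [hV_eq, tsum_noisyThreshold_mul]
  · exact hint _ _ (fun z => hg _) fun z hz => by rw [heq z hz]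
  · exact hint _ _ (fun z => hg _) fun z hz => by rw [heq z hz]

/-! ### The threshold of the first round -/

/-- Right continuity of `Phi` at the infimum; `p < 1` makes the defining set nonempty. -/
theorem le_Phi_PhiInv {p : ℝ} (hp₁ : p < 1) : p ≤ Phi (PhiInv p) := by
  obtain ⟨M, hM⟩ := ((tendsto_cdf_atTop (gaussianReal 0 1)).eventually (lt_mem_nhds hp₁)).exists
  have hne : {x | p ≤ Phi x}.Nonempty := ⟨M, hM.le⟩
  have hgt : ∀ y, PhiInv p < y → p ≤ Phi y := fun y hy => by
    obtain ⟨x, hx, hxy⟩ := exists_lt_of_csInf_lt hne hy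
    exact le_trans hx (monotone_cdf _ hxy.le)
  have hright : Filter.Tendsto Phi (nhdsWithin (PhiInv p) (Set.Ioi (PhiInv p)))
      (nhds (Phi (PhiInv p))) :=
    ((cdf (gaussianReal 0 1)).right_continuous (PhiInv p)).tendsto.mono_left
      (nhdsWithin_mono _ Set.Ioi_subset_Ici_self)
  exact ge_of_tendsto hright (by filter_upwards [self_mem_nhdsWithin] with y hy using hgt y hy)

theorem gaussianReal_Iic {σ : ℝ} (hσ : 0 < σ) (x : ℝ) :
    gaussianReal 0 (Real.toNNReal (σ ^ 2)) (Set.Iic x) = ENNReal.ofReal (Phi (x / σ)) := by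
  have hmap : (gaussianReal 0 1).map (fun y => σ * y) =
      gaussianReal 0 (Real.toNNReal (σ ^ 2)) := by
    rw [gaussianReal_map_const_mul, mul_zero, mul_one]
    congr 1
    ext
    simp [Real.coe_toNNReal _ (sq_nonneg σ)]
  rw [← hmap, Measure.map_apply (by fun_prop) measurableSet_Iic, Phi, ofReal_cdf]
  congr 1
  ext y
  simp [le_div_iff₀ hσ, mul_comm]

/-- With `t` new keys of weight at most `1 / √t`, each stays below `ρ` with probability at least
`p`, where `p ^ t = 1 - δ / 2`. The maximum over `t` is needed because the number of new keys is not
known in advance. -/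
theorem le_prod_gaussianReal_Iic {β : Type*} {δ : ℝ} (hδ₀ : 0 < δ) (hδ₁ : δ < 1) {σ : ℝ}
    (hσ : 0 < σ) {Δ : ℕ} (hΔ : 1 ≤ Δ) {ρ : ℝ}
    (hρ : ρ = (Finset.Icc 1 Δ).sup' (Finset.nonempty_Icc.2 hΔ) fun t : ℕ =>
      1 / Real.sqrt (t : ℝ) + σ * PhiInv ((1 - δ / 2) ^ (1 / (t : ℝ))))
    {N : Finset β} (hN : N.card ≤ Δ) {F : β → ℝ}
    (hF : ∀ u ∈ N, F u ≤ 1 / Real.sqrt (N.card : ℝ)) :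
    1 - ENNReal.ofReal (δ / 2) ≤
      ∏ u ∈ N, gaussianReal 0 (Real.toNNReal (σ ^ 2)) (Set.Iic (ρ - F u)) := by
  rcases N.eq_empty_or_nonempty with rfl | hne
  · simp
  have ht : 1 ≤ N.card := hne.card_pos
  set t := N.card
  have ht' : (0 : ℝ) < t := by exact_mod_cast ht
  set p : ℝ := (1 - δ / 2) ^ (1 / (t : ℝ)) with hp
  have hp₀ : 0 < p := Real.rpow_pos_of_pos (by linarith) _
  have hp₁ : p < 1 := Real.rpow_lt_one (by linarith) (by linarith) (by positivity)
  have hpt : p ^ t = 1 - δ / 2 := by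
    rw [hp, one_div]
    exact Real.rpow_inv_natCast_pow (by linarith) (by omega)
  have hle : 1 / Real.sqrt (t : ℝ) + σ * PhiInv p ≤ ρ := by
    rw [hρ]
    exact Finset.le_sup' (fun t : ℕ =>
      1 / Real.sqrt (t : ℝ) + σ * PhiInv ((1 - δ / 2) ^ (1 / (t : ℝ))))
      (Finset.mem_Icc.2 ⟨ht, hN⟩)
  calc 1 - ENNReal.ofReal (δ / 2) = ENNReal.ofReal p ^ t := by
        rw [← ENNReal.ofReal_pow hp₀.le, hpt, ENNReal.ofReal_sub _ (by linarith),
          ENNReal.ofReal_one]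
    _ = ∏ _u ∈ N, ENNReal.ofReal p := (Finset.prod_const _).symm
    _ ≤ _ := by
        refine Finset.prod_le_prod' fun u hu => ?_
        rw [gaussianReal_Iic hσ]
        refine ENNReal.ofReal_le_ofReal ((le_Phi_PhiInv hp₁).trans (monotone_cdf _ ?_))
        rw [le_div_iff₀ hσ, mul_comm]
        linarith [hF u hu]

/-! ### Contributions and histograms -/

theorem contribution_apply {β : Type*} [DecidableEq β] (U : Finset β) (u : β) :
    contribution U u = if u ∈ U then 1 / Real.sqrt (U.card : ℝ) else 0 := by
  rw [contribution, Finsupp.finsetSum_apply]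
  simp [Finsupp.single_apply]

theorem contribution_nonneg {β : Type*} (U : Finset β) (u : β) : 0 ≤ contribution U u := by
  classical
  rw [contribution_apply]
  split_ifs <;> positivity

theorem sum_sq_contribution_le_one {β : Type*} (U V : Finset β) :
    ∑ u ∈ V, contribution U u ^ 2 ≤ 1 := by
  classical
  have h : ∀ u, contribution U u ^ 2 = if u ∈ U then 1 / (U.card : ℝ) else 0 := fun u => by
    rw [contribution_apply]
    split_ifs
    · rw [div_pow, Real.sq_sqrt (Nat.cast_nonneg _), one_pow]
    · simp
  simp_rw [h]
  rw [← Finset.sum_filter, Finset.sum_const, nsmul_eq_mul]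
  calc ((V.filter (· ∈ U)).card : ℝ) * (1 / U.card) ≤ U.card * (1 / U.card) := by
        gcongr
        intro u hu
        exact (Finset.mem_filter.1 hu).2
    _ ≤ 1 := by
        rw [mul_one_div]
        exact div_self_le_one _

theorem card_le_of_mem_support_limitContribution {β : Type*} {Δ : ℕ} {U U' : Finset β}
    (h : U' ∈ (limitContribution Δ U).support) : U'.card ≤ Δ := by
  unfold limitContribution at h
  split_ifs at h with hU
  · rw [PMF.mem_support_uniformOfFinset_iff, Finset.mem_powersetCard] at h
    exact h.2.le
  · rw [PMF.mem_support_pure_iff] at h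
    rw [h]
    exact not_lt.1 hU

/-- Excludes cancellation: an additional user can only enlarge the set of keys. -/
theorem nonneg_of_mem_support_histogram {β : Type*} {Δ : ℕ} :
    ∀ {Us : List (Finset β)} {H : β →₀ ℝ}, H ∈ (histogram Δ Us).support → ∀ u, 0 ≤ H u
  | [], H, hH, u => by
      rw [histogram, PMF.mem_support_pure_iff] at hH
      simp [hH]
  | U :: Us, H, hH, u => by
      rw [histogram, PMF.mem_support_bind_iff] at hH
      obtain ⟨U', -, hH⟩ := hH
      rw [PMF.mem_support_map_iff] at hH
      obtain ⟨H', hH', rfl⟩ := hH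
      exact add_nonneg (contribution_nonneg U' u) (nonneg_of_mem_support_histogram hH' u)

theorem histogram_perm {β : Type*} (Δ : ℕ) {Us Us' : List (Finset β)} (h : Us.Perm Us') :
    histogram Δ Us = histogram Δ Us' := by
  induction h with
  | nil => rfl
  | cons U _ ih => simp only [histogram, ih]
  | swap U U' Us =>
      simp only [histogram, PMF.map_bind, PMF.map_comp]
      rw [PMF.bind_comm]
      congr 1; ext1 A; congr 1; ext1 B; congr 1; ext1 H
      exact add_left_comm _ _ _
  | trans _ _ ih₁ ih₂ => exact ih₁.trans ih₂

theorem Dominated.toOuterMeasure_le {β : Type*} {s : ℝ} (hs : 0 < s) {v : ℝ≥0}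
    (hv : (v : ℝ) = 1 / s ^ 2) {P Q : PMF β} (h : Dominated v P Q) (ε : ℝ) (S : Set β) :
    P.toOuterMeasure S ≤ ENNReal.ofReal (Real.exp ε) * Q.toOuterMeasure S + ENNReal.ofReal
      (Phi (-ε * s + 1 / (2 * s)) - Real.exp ε * Phi (-ε * s - 1 / (2 * s))) := by
  rw [← gaussianDivergence_one_exp hs hv]
  refine le_trans ?_ (add_le_add_right (h 1 _ ENNReal.one_ne_top ENNReal.ofReal_ne_top) _)
  rw [PMF.toOuterMeasure_apply, PMF.toOuterMeasure_apply, ← ENNReal.tsum_mul_left,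
    ← ENNReal.tsum_add]
  refine ENNReal.tsum_le_tsum fun x => ?_
  by_cases hx : x ∈ S
  · simpa [hx] using le_add_tsub
  · simp [hx]

/-! ### One additional user in a single round -/

theorem dpsu_perm {α : Type*} (Δ : ℕ) (ρ σ : ℝ) {D D' : Database α} (h : D.Perm D') :
    dpsu Δ ρ σ D = dpsu Δ ρ σ D' := by
  rw [dpsu, dpsu, histogram_perm Δ (h.map _)]

theorem extractGrams_perm {α : Type*} (k : ℕ) (V : Finset (Text α)) (Δ : ℕ) (ρ σ : ℝ)
    {D D' : Database α} (h : D.Perm D') :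
    extractGrams k V Δ ρ σ D = extractGrams k V Δ ρ σ D' := by
  rw [extractGrams, extractGrams, histogram_perm Δ (h.map _)]

theorem extractGrams_cons {α : Type*} (k : ℕ) (V : Finset (Text α)) (Δ : ℕ) (ρ : ℝ) {σ : ℝ}
    (hσ : 0 < σ) (w : Text α) (D : Database α) :
    Dominated (Real.toNNReal (1 / σ ^ 2)) (extractGrams k V Δ ρ σ (w :: D))
        (extractGrams k V Δ ρ σ D) ∧
      Dominated (Real.toNNReal (1 / σ ^ 2)) (extractGrams k V Δ ρ σ D)
        (extractGrams k V Δ ρ σ (w :: D)) := by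
  classical
  have hcons : extractGrams k V Δ ρ σ (w :: D) =
      (limitContribution Δ (grams k w ∩ V)).bind fun U =>
        (histogram Δ (D.map fun w => grams k w ∩ V)).bind fun H =>
          noisyThreshold V (contribution U + H) σ ρ := by
    simp only [extractGrams, List.map_cons, histogram, PMF.bind_bind, PMF.bind_map]
    rfl
  -- The additional user's choice is drawn here too and discarded, so that both laws average over
  -- the same `U` and `H`.
  have hconst : extractGrams k V Δ ρ σ D =
      (limitContribution Δ (grams k w ∩ V)).bind fun _ =>
        (histogram Δ (D.map fun w => grams k w ∩ V)).bind fun H =>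
          noisyThreshold V H σ ρ := (PMF.bind_const _ _).symm
  rw [hcons, hconst]
  constructor <;>
    refine Dominated.bind_left _ fun U => Dominated.bind_left _ fun H =>
      dominated_noisyThreshold V hσ ρ ?_
  · simpa using sum_sq_contribution_le_one U V
  · simpa using sum_sq_contribution_le_one U V

theorem dpsu_cons {α : Type*} {δ : ℝ} (hδ₀ : 0 < δ) (hδ₁ : δ < 1) {σ : ℝ} (hσ : 0 < σ) {Δ : ℕ}
    (hΔ : 1 ≤ Δ) {ρ : ℝ}
    (hρ : ρ = (Finset.Icc 1 Δ).sup' (Finset.nonempty_Icc.2 hΔ) fun t : ℕ =>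
      1 / Real.sqrt (t : ℝ) + σ * PhiInv ((1 - δ / 2) ^ (1 / (t : ℝ))))
    (w : Text α) (D : Database α) :
    (∃ M, Close (ENNReal.ofReal (δ / 2)) (dpsu Δ ρ σ (w :: D)) M ∧
        Dominated (Real.toNNReal (1 / σ ^ 2)) M (dpsu Δ ρ σ D)) ∧
      ∃ M, Close (ENNReal.ofReal (δ / 2)) (dpsu Δ ρ σ D) M ∧
        Dominated (Real.toNNReal (1 / σ ^ 2)) M (dpsu Δ ρ σ (w :: D)) := by
  classical
  set L := limitContribution Δ (grams 1 w)
  set 𝓗 := histogram Δ (D.map (grams 1)) with h𝓗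
  have hcons : dpsu Δ ρ σ (w :: D) = L.bind fun U => 𝓗.bind fun H =>
      noisyThreshold (contribution U + H).support (contribution U + H) σ ρ := by
    simp only [dpsu, List.map_cons, histogram, PMF.bind_bind, PMF.bind_map]
    rfl
  have hconst : dpsu Δ ρ σ D = L.bind fun _ => 𝓗.bind fun H =>
      noisyThreshold H.support H σ ρ := (PMF.bind_const _ _).symm
  have hsub : ∀ U, ∀ H ∈ 𝓗.support, H.support ⊆ (contribution U + H).support := by
    intro U H hH u hu
    rw [Finsupp.mem_support_iff] at hu ⊢
    have h₁ := contribution_nonneg U u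
    have h₂ := (nonneg_of_mem_support_histogram hH u).lt_of_ne' hu
    rw [Finsupp.add_apply]
    positivity
  have hnew : ∀ (U : Finset (Text α)) (H : Text α →₀ ℝ), ∀ u ∈ (contribution U + H).support \ H.support, H u = 0 ∧ u ∈ U := by
    intro U H u hu
    rw [Finset.mem_sdiff, Finsupp.mem_support_iff, Finsupp.notMem_support_iff] at hu
    refine ⟨hu.2, ?_⟩
    by_contra hU
    refine hu.1 ?_
    rw [Finsupp.add_apply, hu.2, contribution_apply, if_neg hU, add_zero]
  -- `F` will be `contribution U + H` or `H`; since `H` vanishes on the new keys, both satisfy the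
  -- bound.
  have hprod : ∀ U ∈ L.support, ∀ H ∈ 𝓗.support, ∀ F : Text α → ℝ,
      (∀ u ∈ (contribution U + H).support \ H.support, F u ≤ contribution U u) →
      1 - ENNReal.ofReal (δ / 2) ≤ ∏ u ∈ (contribution U + H).support \ H.support,
        gaussianReal 0 (Real.toNNReal (σ ^ 2)) (Set.Iic (ρ - F u)) := by
    intro U hU H hH F hF
    have hNU : (contribution U + H).support \ H.support ⊆ U := fun u hu => (hnew U H u hu).2
    refine le_prod_gaussianReal_Iic hδ₀ hδ₁ hσ hΔ hρ ((Finset.card_le_card hNU).trans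
      (card_le_of_mem_support_limitContribution hU)) fun u hu => (hF u hu).trans ?_
    -- New keys lie in `U`, so there are at most `|U|` of them and `1 / √|U|` is at most the weight
    -- that `ρ` allows for.
    have hpos : 0 < ((contribution U + H).support \ H.support).card := Finset.card_pos.2 ⟨u, hu⟩
    rw [contribution_apply, if_pos (hNU hu)]
    gcongr
  rw [hcons, hconst]
  -- In each direction `M` takes its weights from the first law and its keys from the second.
  refine ⟨⟨L.bind fun U => 𝓗.bind fun H => noisyThreshold H.support (contribution U + H) σ ρ,
    ?_, ?_⟩, L.bind fun U => 𝓗.bind fun H => noisyThreshold (contribution U + H).support H σ ρ,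
    ?_, ?_⟩
  · refine Close.bind_left fun U hU => Close.bind_left fun H hH => ?_
    refine (close_noisyThreshold (hsub U H hH) (contribution U + H) σ ρ (hprod U hU H hH _ ?_)).1
    intro u hu
    simp [(hnew U H u hu).1]
  · refine Dominated.bind_left _ fun U => Dominated.bind_left _ fun H =>
      dominated_noisyThreshold _ hσ ρ ?_
    simpa using sum_sq_contribution_le_one U _
  · refine Close.bind_left fun U hU => Close.bind_left fun H hH => ?_
    refine (close_noisyThreshold (hsub U H hH) H σ ρ (hprod U hU H hH _ ?_)).2
    intro u hu
    rw [(hnew U H u hu).1]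
    exact contribution_nonneg U u
  · refine Dominated.bind_left _ fun U => Dominated.bind_left _ fun H =>
      dominated_noisyThreshold _ hσ ρ ?_
    simpa using sum_sq_contribution_le_one U _

/-! ### Composition of all rounds -/

/-- The rounds `2, …, k + 1` of the algorithm, started from a random set `S₁` with law `P`. -/
def extend {α : Type*} (Δ : ℕ → ℕ) (ρ : ℕ → (ℕ → Finset (Text α)) → ℝ) (σ : ℕ → ℝ)
    (D : Database α) (P : PMF (Finset (Text α))) : ℕ → PMF (ℕ → Finset (Text α))
  | 0 => P.map fun S₁ => Function.update (fun _ => ∅) 1 S₁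
  | k + 1 => (extend Δ ρ σ D P k).bind fun S =>
      (extractGrams (k + 2) (validGrams (S 1) (S (k + 1))) (Δ (k + 2)) (ρ (k + 2) S)
        (σ (k + 2)) D).map fun A => Function.update S (k + 2) A

section

variable {α : Type*} {Δ : ℕ → ℕ} {ρ : ℕ → (ℕ → Finset (Text α)) → ℝ} {σ : ℕ → ℝ}

theorem dpne_succ (ρ₁ : ℝ) (D : Database α) (k : ℕ) :
    dpne Δ ρ₁ ρ σ D (k + 1) = extend Δ ρ σ D (dpsu (Δ 1) ρ₁ (σ 1) D) k := by
  induction k with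
  | zero => rfl
  | succ k ih => rw [dpne, extend, ih]

theorem dpne_perm (ρ₁ : ℝ) {D D' : Database α} (h : D.Perm D') (k : ℕ) :
    dpne Δ ρ₁ ρ σ D (k + 1) = dpne Δ ρ₁ ρ σ D' (k + 1) := by
  rw [dpne_succ, dpne_succ, dpsu_perm _ _ _ h]
  induction k with
  | zero => rfl
  | succ k ih =>
    rw [extend, extend, ih]
    simp_rw [extractGrams_perm _ _ _ _ _ h]

/-- The later rounds apply the same kernels to both laws, hence are post-processing. -/
theorem Close.extend {η : ℝ≥0∞} {P Q : PMF (Finset (Text α))} (h : Close η P Q)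
    (D : Database α) (k : ℕ) : Close η (extend Δ ρ σ D P k) (extend Δ ρ σ D Q k) := by
  induction k with
  | zero => exact h.bind _
  | succ k ih => exact ih.bind _

theorem Dominated.extend {D D' : Database α} {P Q : PMF (Finset (Text α))}
    (h : Dominated (Real.toNNReal (1 / σ 1 ^ 2)) P Q) (k : ℕ)
    (hstep : ∀ j ∈ Finset.Icc 1 (k + 1), ∀ V r, Dominated (Real.toNNReal (1 / σ j ^ 2))
      (extractGrams j V (Δ j) r (σ j) D) (extractGrams j V (Δ j) r (σ j) D')) :
    Dominated (∑ j ∈ Finset.Icc 1 (k + 1), Real.toNNReal (1 / σ j ^ 2))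
      (DPNE.extend Δ ρ σ D P k) (DPNE.extend Δ ρ σ D' Q k) := by
  induction k with
  | zero =>
    rw [zero_add, Finset.Icc_self, Finset.sum_singleton]
    exact h.map _
  | succ k ih =>
    rw [Finset.sum_Icc_succ_top (by omega)]
    refine (ih fun j hj => hstep j ?_).bind fun S => (hstep _ ?_ _ _).map _
    · rw [Finset.mem_Icc] at hj ⊢; omega
    · rw [Finset.mem_Icc]; omega

end

end DPNE

end

open DPNE in
theorem mainTheorem1 {α : Type*} (ε δ : ℝ) (hε : 0 < ε) (hδ₀ : 0 < δ) (hδ₁ : δ < 1)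
    (σs : ℝ) (hσs : 0 < σs)
    (hσs_eq : δ / 2 = DPNE.Phi (-ε * σs + 1 / (2 * σs))
      - Real.exp ε * DPNE.Phi (-ε * σs - 1 / (2 * σs)))
    (T : ℕ) (hT : 1 ≤ T)
    (σ : ℕ → ℝ) (hσ : ∀ k ∈ Finset.Icc 1 T, 0 < σ k)
    (hσ_eq : 1 / σs = Real.sqrt (∑ k ∈ Finset.Icc 1 T, 1 / σ k ^ 2))
    (Δ : ℕ → ℕ) (hΔ : 1 ≤ Δ 1)
    (ρ₁ : ℝ)
    (hρ₁ : ρ₁ = (Finset.Icc 1 (Δ 1)).sup' (Finset.nonempty_Icc.2 hΔ) fun t : ℕ =>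
      1 / Real.sqrt (t : ℝ) + σ 1 * DPNE.PhiInv ((1 - δ / 2) ^ (1 / (t : ℝ))))
    (ρ : ℕ → (ℕ → Finset (DPNE.Text α)) → ℝ) :
    DPNE.IsDifferentiallyPrivate DPNE.Adjacent ε δ
      (fun D : DPNE.Database α => DPNE.dpne Δ ρ₁ ρ σ D T) := by
  obtain ⟨k, rfl⟩ : ∃ k, T = k + 1 := ⟨T - 1, by omega⟩
  have hv : ((∑ j ∈ Finset.Icc 1 (k + 1), Real.toNNReal (1 / σ j ^ 2) : NNReal) : ℝ) =
      1 / σs ^ 2 := by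
    rw [← one_div_pow, hσ_eq, Real.sq_sqrt (Finset.sum_nonneg fun j _ => by positivity)]
    push_cast
    exact Finset.sum_congr rfl fun j _ => Real.coe_toNNReal _ (by positivity)
  -- The intermediate law is `M` continued by the later rounds on `D`: it is close to the output on
  -- `D`, and dominated relative to the output on `D'`.
  have key : ∀ (D D' : Database α) (M : PMF (Finset (Text α))),
      Close (ENNReal.ofReal (δ / 2)) (dpsu (Δ 1) ρ₁ (σ 1) D) M →
      Dominated (Real.toNNReal (1 / σ 1 ^ 2)) M (dpsu (Δ 1) ρ₁ (σ 1) D') →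
      (∀ j ∈ Finset.Icc 1 (k + 1), ∀ V r, Dominated (Real.toNNReal (1 / σ j ^ 2))
        (extractGrams j V (Δ j) r (σ j) D) (extractGrams j V (Δ j) r (σ j) D')) →
      ∀ S : Set (ℕ → Finset (Text α)), (dpne Δ ρ₁ ρ σ D (k + 1)).toOuterMeasure S ≤
        ENNReal.ofReal (Real.exp ε) * (dpne Δ ρ₁ ρ σ D' (k + 1)).toOuterMeasure S
          + ENNReal.ofReal δ := by
    intro D D' M hclose hdom hstep S
    have h₁ := (hclose.extend (Δ := Δ) (ρ := ρ) (σ := σ) D k).toOuterMeasure_le S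
    have h₂ := (hdom.extend (ρ := ρ) k hstep).toOuterMeasure_le hσs hv ε S
    rw [← hσs_eq] at h₂
    rw [dpne_succ, dpne_succ]
    calc _ ≤ _ := h₁
      _ ≤ _ := add_le_add_left h₂ _
      _ = _ := by
        rw [add_assoc, ← ENNReal.ofReal_add (by linarith) (by linarith), add_halves]
  rintro D D' ⟨w, h | h⟩ S
  · obtain ⟨-, M, hM, hM'⟩ := dpsu_cons hδ₀ hδ₁ (hσ 1 (by simp)) hΔ hρ₁ w D
    simp only [dpne_perm ρ₁ h]
    exact key D (w :: D) M hM hM'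
      (fun j hj V r => (extractGrams_cons j V (Δ j) r (hσ j hj) w D).2) S
  · obtain ⟨⟨M, hM, hM'⟩, -⟩ := dpsu_cons hδ₀ hδ₁ (hσ 1 (by simp)) hΔ hρ₁ w D'
    simp only [dpne_perm ρ₁ h]
    exact key (w :: D') D' M hM hM'
      (fun j hj V r => (extractGrams_cons j V (Δ j) r (hσ j hj) w D').1) S
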